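/- Let $Q$ be an $n$-dimensional smooth manifold with a smooth contravariant metric $\mathbf G=(g^{ij})$ of arbitrary signature (a symmetric nondegenerate bilinear form on each cotangent space). Let $(q^1,\dots,q^n)$ be smooth local coordinates on an open set $U\subseteq Q$ which are orthogonal, $g^{ij}=\mathbf G(dq^i,dq^j)=0$ on $U$ for $i\ne j$, and conformal separable: there is a smooth nowhere vanishing function $\sigma$ on $U$ such that the geodesic Hamiltonian $\frac12\sigma^{-1}g^{ij}p_ip_j$ of $\mathbf G/\sigma$ is separable in the coordinates $(q^i)$, i.e. near every point of $U$ its Hamilton–Jacobi equation $\frac12\sigma^{-1}g^{ij}\,\partial_iS\,\partial_jS=h$ has a complete integral $S=\sum_i W_i(q^i,c_1,\dots,c_n)$, $\det(\partial^2S/\partial q^i\partial c_j)\neq0$. For each $i$ let $\mathbf E_i$ be a smooth nowhere vanishing vector field on $U$ normal to the foliation $q^i=\mathrm{const}$ of this orthogonal conformal separable web, that is, at each point a nonzero multiple of the $\mathbf G$-gradient of $q^i$. A smooth vector field $\mathbf X$ is a conformal Killing vector of a contravariant metric $\mathbf H$ if $\mathcal L_{\mathbf X}\mathbf H=F\,\mathbf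 H$ for some function $F$, and a Killing vector of $\mathbf H$ if $\mathcal L_{\mathbf X}\mathbf H=0$. Fix $i$ and suppose that $\mathbf E_i$ is, up to a factor, a conformal Killing vector of $\mathbf G$: there is a nowhere vanishing function $f$ on $U$ such that $f\,\mathbf E_i$ is a conformal Killing vector of $\mathbf G$ on $U$. Then for every $k\neq i$ the function $g^{kk}=\mathbf G(dq^k,dq^k)$ vanishes nowhere on $U$, and the same field $f\,\mathbf E_i$ is a Killing vector, on $U$, of the conformal metric $\mathbf G/g^{kk}$. -/

import Mathlib

open scoped Manifold ContDiff

noncomputable section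

namespace ConformalSeparation

variable {n : ℕ} {M : Type*} [TopologicalSpace M]
  [ChartedSpace (EuclideanSpace ℝ (Fin n)) M]

/-- The cotangent space of the `n`-dimensional manifold `M` at `x`. -/
abbrev Cotangent (n : ℕ) {M : Type*} [TopologicalSpace M]
    [ChartedSpace (EuclideanSpace ℝ (Fin n)) M] (x : M) : Type :=
  TangentSpace (𝓡 n) x →L[ℝ] ℝ

/-- Vector fields on `M` (smoothness is a separate condition). -/
abbrev VField (n : ℕ) (M : Type*) [TopologicalSpace M]
    [ChartedSpace (EuclideanSpace ℝ (Fin n)) M] : Type _ :=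
  (x : M) → TangentSpace (𝓡 n) x

/-- Contravariant two-tensor fields on `M`: at each point a bilinear form on the cotangent
space (smoothness and symmetry are separate conditions). -/
abbrev Tensor2 (n : ℕ) (M : Type*) [TopologicalSpace M]
    [ChartedSpace (EuclideanSpace ℝ (Fin n)) M] : Type _ :=
  (x : M) → LinearMap.BilinForm ℝ (Cotangent n x)

/-- The differential `du` of a real function at `x`, as a covector. -/
def diff (n : ℕ) {M : Type*} [TopologicalSpace M]
    [ChartedSpace (EuclideanSpace ℝ (Fin n)) M] (u : M → ℝ) (x : M) : Cotangent n x :=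
  mfderiv (𝓡 n) 𝓘(ℝ, ℝ) u x

/-- The derivative `X(u) = du(X)` of a function along a vector field. -/
def derivAlong (X : VField n M) (u : M → ℝ) (x : M) : ℝ :=
  diff n u x (X x)

/-- The function `H(du, dv)`. -/
def pairing (H : Tensor2 n M) (u v : M → ℝ) (x : M) : ℝ :=
  H x (diff n u x) (diff n v x)

/-- Smoothness of a real function on a set. -/
def SmoothFunOn (n : ℕ) {M : Type*} [TopologicalSpace M]
    [ChartedSpace (EuclideanSpace ℝ (Fin n)) M] (u : M → ℝ) (U : Set M) : Prop :=
  ContMDiffOn (𝓡 n) 𝓘(ℝ, ℝ) ∞ u U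

/-- Smoothness of a vector field on a set. -/
def SmoothVFieldOn [IsManifold (𝓡 n) ∞ M] (X : VField n M) (U : Set M) : Prop :=
  ContMDiffOn (𝓡 n) (𝓡 n).tangent ∞
    (fun x => (⟨x, X x⟩ : TangentBundle (𝓡 n) M)) U

/-- A contravariant metric of arbitrary signature: symmetric, nondegenerate and smooth.
Smoothness says that `G(du, dv)` is smooth for all locally defined smooth functions `u`, `v`;
taking coordinate functions, this is smoothness of all the components `g^{ij}`. -/
structure IsMetric (G : Tensor2 n M) : Prop where
  symm : ∀ x, (G x).IsSymm
  nondegenerate : ∀ x, (G x).Nondegenerate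
  smooth : ∀ V : Set M, IsOpen V → ∀ u v : M → ℝ,
    SmoothFunOn n u V → SmoothFunOn n v V → SmoothFunOn n (pairing G u v) V

/-- The conformal tensor `G / σ`, for a function `σ`. -/
def conformal (G : Tensor2 n M) (σ : M → ℝ) : Tensor2 n M :=
  fun x => (σ x)⁻¹ • G x

/-- The Lie derivative of a contravariant two-tensor evaluated on the differentials of two
functions, by the Leibniz rule and `ℒ_X du = d(X u)`:
`(ℒ_X H)(du, dv) = X(H(du, dv)) - H(d(Xu), dv) - H(du, d(Xv))`. -/
def lieDeriv (X : VField n M) (H : Tensor2 n M) (u v : M → ℝ) (x : M) : ℝ :=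
  derivAlong X (pairing H u v) x
    - pairing H (derivAlong X u) v x
    - pairing H u (derivAlong X v) x

/-- `X` is, on the open set `U`, a conformal Killing vector of `G`: `ℒ_X G = F G` for some
function `F`.  The equation of tensors is tested on the differentials of locally defined smooth
functions; these exhaust the cotangent space at every point. -/
def IsConformalKilling [IsManifold (𝓡 n) ∞ M] (G : Tensor2 n M) (X : VField n M) (U : Set M) : Prop :=
  SmoothVFieldOn X U ∧ ∃ F : M → ℝ,
    ∀ V : Set M, IsOpen V → V ⊆ U → ∀ u v : M → ℝ,
      SmoothFunOn n u V → SmoothFunOn n v V →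
        ∀ x ∈ V, lieDeriv X G u v x = F x * pairing G u v x

/-- `X` is, on the open set `U`, a Killing vector of `G`: `ℒ_X G = 0`. -/
def IsKilling [IsManifold (𝓡 n) ∞ M] (G : Tensor2 n M) (X : VField n M) (U : Set M) : Prop :=
  SmoothVFieldOn X U ∧
    ∀ V : Set M, IsOpen V → V ⊆ U → ∀ u v : M → ℝ,
      SmoothFunOn n u V → SmoothFunOn n v V →
        ∀ x ∈ V, lieDeriv X G u v x = 0

/-- The `i`-th coordinate function `q^i` of a chart. -/
def coord (q : OpenPartialHomeomorph M (EuclideanSpace ℝ (Fin n))) (i : Fin n) (x : M) : ℝ :=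
  q x i

/-- The component `g^{ij} = G(dq^i, dq^j)` of a contravariant two-tensor in a chart. -/
def component (G : Tensor2 n M) (q : OpenPartialHomeomorph M (EuclideanSpace ℝ (Fin n)))
    (i j : Fin n) (x : M) : ℝ :=
  pairing G (coord q i) (coord q j) x

/-- The geodesic Hamiltonian `½ H^{ij} p_i p_j` is separable in the coordinates `q`: near every
point of the coordinate domain, the Hamilton--Jacobi equation `½ H(dS, dS) = h` has a complete
integral of the form `S = ∑ i, W_i(q^i, c)`, depending on `n` parameters `c = (c_j)` with
`det (∂² S / ∂q^i ∂c_j) ≠ 0`. -/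
def IsSeparable (H : Tensor2 n M)
    (q : OpenPartialHomeomorph M (EuclideanSpace ℝ (Fin n))) : Prop :=
  ∀ x₀ ∈ q.source, ∃ V : Set M, IsOpen V ∧ x₀ ∈ V ∧ V ⊆ q.source ∧
    ∃ (C : Set (Fin n → ℝ)) (W : Fin n → ℝ → (Fin n → ℝ) → ℝ) (h : (Fin n → ℝ) → ℝ),
      IsOpen C ∧ C.Nonempty ∧
      (∀ i, ContDiffOn ℝ ∞ (fun p : ℝ × (Fin n → ℝ) => W i p.1 p.2)
        ((coord q i '' V) ×ˢ C)) ∧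
      (∀ c ∈ C, ∀ x ∈ V,
        (1 / 2 : ℝ) * pairing H (fun y => ∑ i, W i (coord q i y) c)
          (fun y => ∑ i, W i (coord q i y) c) x = h c) ∧
      (∀ c ∈ C, ∀ x ∈ V,
        (Matrix.of fun i j : Fin n =>
          deriv (fun t => fderiv ℝ (fun c' => W i t c') c (Pi.single j 1))
            (coord q i x)).det ≠ 0)

/-- The geodesic Hamiltonian of `G` is conformal separable in the coordinates `q`: that of
`G / σ` is separable in them for some nowhere zero smooth function `σ`. -/
def IsConformalSeparable (G : Tensor2 n M)
    (q : OpenPartialHomeomorph M (EuclideanSpace ℝ (Fin n))) : Prop :=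
  ∃ σ : M → ℝ, SmoothFunOn n σ q.source ∧ (∀ x ∈ q.source, σ x ≠ 0) ∧
    IsSeparable (conformal G σ) q

/-- The orthogonal conformal separable web of the coordinates `q`: the coordinates are smooth,
orthogonal for `G`, and conformal separable; the web consists of the `n` pairwise orthogonal
foliations `q^i = const`, and `E i` is a smooth vector field normal to the `i`-th one, i.e.
at each point a nonzero multiple of the `G`-gradient of `q^i`. -/
structure IsOrthogonalConformalSeparableWeb [IsManifold (𝓡 n) ∞ M] (G : Tensor2 n M)
    (q : OpenPartialHomeomorph M (EuclideanSpace ℝ (Fin n))) (E : Fin n → VField n M) :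
    Prop where
  chart : q ∈ IsManifold.maximalAtlas (𝓡 n) ∞ M
  orthogonal : ∀ i j, i ≠ j → ∀ x ∈ q.source, component G q i j x = 0
  separable : IsConformalSeparable G q
  smooth : ∀ i, SmoothVFieldOn (E i) q.source
  normal : ∀ i, ∀ x ∈ q.source, ∃ r : ℝ, r ≠ 0 ∧
    ∀ β : Cotangent n x, β (E i x) = r * G x (diff n (coord q i) x) β

end ConformalSeparation

end

namespace ConformalSeparation

section

variable {n : ℕ} {M : Type*} [TopologicalSpace M]
  [ChartedSpace (EuclideanSpace ℝ (Fin n)) M]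

/-! Write `X = f E_i` and `ℒ_X G = F G`. Since `X` is proportional to the gradient of `q^i`,
orthogonality gives `X(q^k) = 0` for `k ≠ i`. The two correction terms of `(ℒ_X G)(dq^k, dq^k)` then
vanish, leaving `X(g^{kk}) = F g^{kk}`. Thus `g^{kk}` scales along `X` with the same factor as `G`,
and the Leibniz rule `lieDeriv_conformal` gives `ℒ_X (G/g^{kk}) = 0`. This is
`IsConformalKilling.isKilling_conformal` with `w = q^k`. Division by `g^{kk}` is legitimate by
`component_self_ne_zero`: were it zero at a point, `dq^k` would be `G`-orthogonal to every `dq^j`,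
hence to the whole cotangent space, against nondegeneracy. -/

theorem diff_congr {u v : M → ℝ} {x : M} (h : u =ᶠ[nhds x] v) : diff n u x = diff n v x := by
  unfold diff
  exact h.mfderiv_eq

theorem diff_eq_zero {u : M → ℝ} {x : M} (h : ∀ᶠ y in nhds x, u y = 0) : diff n u x = 0 := by
  have h' : u =ᶠ[nhds x] fun _ => (0 : ℝ) := h
  rw [diff_congr h']
  unfold diff
  exact mfderiv_const

theorem SmoothFunOn.mdifferentiableAt {u : M → ℝ} {V : Set M} (hu : SmoothFunOn n u V)
    (hV : IsOpen V) {x : M} (hx : x ∈ V) : MDifferentiableAt (𝓡 n) 𝓘(ℝ, ℝ) u x :=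
  (ContMDiffOn.contMDiffAt hu (hV.mem_nhds hx)).mdifferentiableAt (by simp)

theorem derivAlong_mul (X : VField n M) {u v : M → ℝ} {x : M}
    (hu : MDifferentiableAt (𝓡 n) 𝓘(ℝ, ℝ) u x) (hv : MDifferentiableAt (𝓡 n) 𝓘(ℝ, ℝ) v x) :
    derivAlong X (fun y => u y * v y) x = u x * derivAlong X v x + v x * derivAlong X u x := by
  have h := (hu.hasMFDerivAt.mul hv.hasMFDerivAt).mfderiv
  unfold derivAlong diff
  exact congrArg (fun L : Cotangent n x => L (X x)) h

theorem derivAlong_inv (X : VField n M) {u : M → ℝ} {x : M}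
    (hu : MDifferentiableAt (𝓡 n) 𝓘(ℝ, ℝ) u x) (h0 : u x ≠ 0) :
    derivAlong X (fun y => (u y)⁻¹) x = -(u x ^ 2)⁻¹ * derivAlong X u x := by
  have h := (hu.hasMFDerivAt.inv h0).mfderiv
  unfold derivAlong diff
  exact congrArg (fun L : Cotangent n x => L (X x)) h

/-- The Leibniz rule `ℒ_X (G/σ) = σ⁻¹ ℒ_X G - σ⁻² X(σ) G`. -/
theorem lieDeriv_conformal (X : VField n M) (G : Tensor2 n M) {σ u v : M → ℝ} {x : M}
    (hσ : MDifferentiableAt (𝓡 n) 𝓘(ℝ, ℝ) σ x) (h0 : σ x ≠ 0)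
    (hG : MDifferentiableAt (𝓡 n) 𝓘(ℝ, ℝ) (pairing G u v) x) :
    lieDeriv X (conformal G σ) u v x =
      (σ x)⁻¹ * lieDeriv X G u v x - (σ x ^ 2)⁻¹ * derivAlong X σ x * pairing G u v x := by
  have hp (a b : M → ℝ) (y : M) :
      pairing (conformal G σ) a b y = (σ y)⁻¹ * pairing G a b y := rfl
  have hinv : MDifferentiableAt (𝓡 n) 𝓘(ℝ, ℝ) (fun y => (σ y)⁻¹) x :=
    (hσ.hasMFDerivAt.inv h0).mdifferentiableAt
  unfold lieDeriv
  -- The first term differentiates the pairing, so it is rewritten as a function; the other two need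
  -- only its value at `x`.
  rw [show pairing (conformal G σ) u v = fun y => (σ y)⁻¹ * pairing G u v y from rfl,
    derivAlong_mul X hinv hG, derivAlong_inv X hσ h0, hp, hp]
  ring

variable {q : OpenPartialHomeomorph M (EuclideanSpace ℝ (Fin n))}

theorem smoothFunOn_coord (hq : q ∈ IsManifold.maximalAtlas (𝓡 n) ∞ M) (i : Fin n) :
    SmoothFunOn n (coord q i) q.source :=
  (EuclideanSpace.proj (𝕜 := ℝ) i : EuclideanSpace ℝ (Fin n) →L[ℝ] ℝ).contMDiff.comp_contMDiffOn
    (contMDiffOn_of_mem_maximalAtlas hq)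

theorem mdifferentiable_of_mem_maximalAtlas (hq : q ∈ IsManifold.maximalAtlas (𝓡 n) ∞ M) :
    q.MDifferentiable (𝓡 n) (𝓡 n) :=
  ⟨(contMDiffOn_of_mem_maximalAtlas hq).mdifferentiableOn (by simp),
    (contMDiffOn_symm_of_mem_maximalAtlas hq).mdifferentiableOn (by simp)⟩

theorem diff_coord_apply (hq : q ∈ IsManifold.maximalAtlas (𝓡 n) ∞ M) (i : Fin n) {x : M}
    (hx : x ∈ q.source) (v : TangentSpace (𝓡 n) x) :
    diff n (coord q i) x v
      = EuclideanSpace.proj (𝕜 := ℝ) i (mfderiv (𝓡 n) (𝓡 n) q x v) := by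
  have h := (EuclideanSpace.proj (𝕜 := ℝ) i :
    EuclideanSpace ℝ (Fin n) →L[ℝ] ℝ).hasMFDerivAt.comp x
    ((mdifferentiable_of_mem_maximalAtlas hq).mdifferentiableAt hx).hasMFDerivAt
  unfold diff
  exact congrArg (fun L : Cotangent n x => L v) h.mfderiv

/-- The derivative of the chart is onto, so some tangent vector maps to the `i`-th basis vector, and
`dq^i` takes the value 1 on it. -/
theorem diff_coord_ne_zero (hq : q ∈ IsManifold.maximalAtlas (𝓡 n) ∞ M) (i : Fin n) {x : M}
    (hx : x ∈ q.source) : diff n (coord q i) x ≠ 0 := by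
  intro h
  obtain ⟨v, hv⟩ := (mdifferentiable_of_mem_maximalAtlas hq).mfderiv_surjective hx
    (EuclideanSpace.single i (1 : ℝ) : EuclideanSpace ℝ (Fin n))
  have h1 := diff_coord_apply hq i hx v
  rw [h, hv] at h1
  simp at h1

/-- The coordinate differentials span the cotangent space. -/
theorem exists_eq_sum_diff_coord (hq : q ∈ IsManifold.maximalAtlas (𝓡 n) ∞ M) {x : M}
    (hx : x ∈ q.source) (β : Cotangent n x) :
    ∃ b : Fin n → ℝ, β = ∑ j, b j • diff n (coord q j) x := by
  let A := (mdifferentiable_of_mem_maximalAtlas hq).mfderiv hx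
  let e (j : Fin n) : TangentSpace (𝓡 n) (q x) :=
    (EuclideanSpace.single j (1 : ℝ) : EuclideanSpace ℝ (Fin n))
  -- The coefficients are the values of `β` on the coordinate vectors `∂/∂q^j = A.symm (e j)`.
  refine ⟨fun j => β (A.symm (e j)), ContinuousLinearMap.ext fun v => ?_⟩
  have hv : A v = ∑ j, (diff n (coord q j) x v) • e j := by
    have h := (EuclideanSpace.basisFun (Fin n) ℝ).sum_repr (A v)
    simp only [EuclideanSpace.basisFun_apply] at h
    simp only [diff_coord_apply hq _ hx]
    exact h.symm
  have hv' : v = ∑ j, (diff n (coord q j) x v) • A.symm (e j) :=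
    A.injective (by simp only [map_sum, map_smul, A.apply_symm_apply]; exact hv)
  conv_lhs => rw [hv', map_sum]
  rw [sum_apply]
  refine Finset.sum_congr rfl fun j _ => ?_
  rw [map_smul, smul_apply, smul_eq_mul, smul_eq_mul, mul_comm]

theorem component_self_ne_zero {G : Tensor2 n M} (hG : IsMetric G)
    (hq : q ∈ IsManifold.maximalAtlas (𝓡 n) ∞ M)
    (ho : ∀ i j, i ≠ j → ∀ x ∈ q.source, component G q i j x = 0) (k : Fin n) {x : M}
    (hx : x ∈ q.source) : component G q k k x ≠ 0 := by
  intro h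
  refine diff_coord_ne_zero hq k hx ((hG.nondegenerate x).1 _ fun β => ?_)
  obtain ⟨b, rfl⟩ := exists_eq_sum_diff_coord hq hx β
  rw [map_sum]
  refine Finset.sum_eq_zero fun j _ => ?_
  have hj : G x (diff n (coord q k) x) (diff n (coord q j) x) = 0 := by
    rcases eq_or_ne k j with rfl | hkj
    · exact h
    · exact ho k j hkj x hx
  rw [map_smul, hj, smul_zero]

/-- A conformal Killing vector which annihilates a function `w` with `G(dw, dw)` nowhere zero is
a Killing vector of `G / G(dw, dw)`. -/
theorem IsConformalKilling.isKilling_conformal [IsManifold (𝓡 n) ∞ M] {G : Tensor2 n M} (hG : IsMetric G)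
    {X : VField n M} {U : Set M} (hU : IsOpen U) (hX : IsConformalKilling G X U) {w : M → ℝ}
    (hw : SmoothFunOn n w U) (h0 : ∀ x ∈ U, pairing G w w x ≠ 0)
    (hXw : ∀ x ∈ U, derivAlong X w x = 0) :
    IsKilling (conformal G (pairing G w w)) X U := by
  obtain ⟨hXs, F, hF⟩ := hX
  refine ⟨hXs, fun V hV hVU u v hu hv x hx => ?_⟩
  have hxU := hVU hx
  -- `ℒ_X G` involves `d(Xw)`, so `Xw = 0` is needed on a neighbourhood of `x`; this is where `U`
  -- being open enters.
  have hd : diff n (derivAlong X w) x = 0 :=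
    diff_eq_zero (Filter.eventually_of_mem (hU.mem_nhds hxU) hXw)
  -- The conformal Killing equation tested on `u = v = w`.
  have hFw : derivAlong X (pairing G w w) x = F x * pairing G w w x := by
    rw [← hF U hU subset_rfl w w hw hw x hxU]
    simp [lieDeriv, pairing, hd]
  have hne := h0 x hxU
  rw [lieDeriv_conformal X G ((hG.smooth U hU w w hw hw).mdifferentiableAt hU hxU) hne
    ((hG.smooth V hV u v hu hv).mdifferentiableAt hV hx), hF V hV hVU u v hu hv x hx, hFw]
  field_simp
  ring

end

end ConformalSeparation

open ConformalSeparation in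
theorem proposition5p10 {n : ℕ} {M : Type*} [TopologicalSpace M]
    [ChartedSpace (EuclideanSpace ℝ (Fin n)) M] [IsManifold (𝓡 n) ∞ M]
    (G : Tensor2 n M) (hG : IsMetric G)
    (q : OpenPartialHomeomorph M (EuclideanSpace ℝ (Fin n)))
    (E : Fin n → VField n M) (hE : IsOrthogonalConformalSeparableWeb G q E)
    (i : Fin n) (f : M → ℝ) (hf : ∀ x ∈ q.source, f x ≠ 0)
    (hCKV : IsConformalKilling G (fun x => f x • E i x) q.source) :
    ∀ k : Fin n, k ≠ i →
      (∀ x ∈ q.source, component G q k k x ≠ 0) ∧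
      IsKilling (conformal G (component G q k k)) (fun x => f x • E i x) q.source := by
  intro k hk
  have h0 (x : M) (hx : x ∈ q.source) : component G q k k x ≠ 0 :=
    component_self_ne_zero hG hE.chart hE.orthogonal k hx
  refine ⟨h0, hCKV.isKilling_conformal hG q.open_source (smoothFunOn_coord hE.chart k) h0
    fun x hx => ?_⟩
  obtain ⟨r, -, hr⟩ := hE.normal i x hx
  have ho : G x (diff n (coord q i) x) (diff n (coord q k) x) = 0 :=
    hE.orthogonal i k hk.symm x hx
  -- `X(q^k) = f r g^{ik} = 0`.
  rw [derivAlong, map_smul, hr, ho, mul_zero, smul_zero]
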